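/- Corollary (Collaborative sampling). Let $m,T,N\ge 1$ be integers, $A^*\in\mathbb R^{m\times T}$, and consider observations $$Y_i=\operatorname{tr}(X_i'A^*)+\xi_i,\qquad i=1,\dots,N,$$ with matrix completion by collaborative sampling: the masks $X_1,\dots,X_N\in\mathbb R^{m\times T}$, random or deterministic, are pairwise distinct elements of $\{e_k(m)e_l(T)' : 1\le k\le m,\ 1\le l\le T\}$ ($e_k(d)$ the canonical basis vectors of $\mathbb R^d$), and $(X_1,\dots,X_N)$ is independent of the errors $(\xi_1,\dots,\xi_N)$. Write $\|A\|_{S_1}=\sum_{j=1}^{\min(m,T)}\sigma_j(A)$ for the sum of the singular values of $A$, and $\hat d_{2,N}(A,B)^2=\frac1N\sum_{i=1}^N\operatorname{tr}(X_i'(A-B))^2$. For $\lambda\ge 0$, the Schatten-$1$ estimator $\hat A$ with parameter $\lambda$ is any solution of $$\min_{A\in\mathbb R^{m\times T}}\Bigl(\frac1N\sum_{i=1}^N\bigl(Y_i-\operatorname{tr}(X_i'A)\bigr)^2+\lambda\|A\|_{S_1}\Bigr).$$ Let $D\ge 2$ and $\sigma\ge 0$. (i) Let $\xi_1,\dots,\xi_N$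 be i.i.d. $\mathcal N(0,\sigma^2)$ random variables and let $\lambda=4\tau_4$ with $\tau_4=8\sigma\sqrt D\,\frac{\sqrt{m+T}}{N}$. Then, with probability at least $1-2\exp\{-(D-\log 5)(m+T)\}$, $$\hat d_{2,N}(\hat A,A^*)^2\le 16\,\bar C\,\|A^*\|_{S_1}\frac{\sqrt{m+T}}{N},\qquad \bar C=8\sigma\sqrt D.$$ (ii) Let $\xi_1,\dots,\xi_N$ be i.i.d. zero-mean random variables satisfying the Bernstein condition $\max_{1\le i\le N}\mathbb E|\xi_i|^l\le\frac12\,l!\,\sigma^2H^{l-2}$ for $l=2,3,\dots$, with some $H\ge 0$ (with $0^0=1$), and let $\lambda=4\tau_5$ with $\tau_5=\frac{4\sigma\sqrt{2D(m+T)}+8HD(m+T)}{N}$. Then, with probability at least $1-2\exp\{-(D-\log 5)(m+T)\}$, $$\hat d_{2,N}(\hat A,A^*)^2\le 64\,\|A^*\|_{S_1}\frac{\sigma\sqrt{2D(m+T)}+2HD(m+T)}{N}.$$ -/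

import Mathlib

open MeasureTheory ProbabilityTheory
open scoped Matrix

noncomputable section

namespace TraceRegression

/-- The `j`-th singular value of a real matrix (zero-indexed, in decreasing order). -/
def singularValue {m T : ℕ} (A : Matrix (Fin m) (Fin T) ℝ) (j : ℕ) : ℝ :=
  (Matrix.toEuclideanLin A).singularValues j

/-- The Schatten (quasi-)norm `‖A‖_{S_p} = (∑_{j ≤ min(m,T)} σ_j(A)^p)^{1/p}`, for `0 < p < ∞`. -/
def schattenNorm {m T : ℕ} (p : ℝ) (A : Matrix (Fin m) (Fin T) ℝ) : ℝ :=
  (∑ j ∈ Finset.range (min m T), singularValue A j ^ p) ^ (1 / p)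

/-- The point masks with exactly one nonzero entry, which equals `1`:
the matrices `e_k(m) e_l(T)'`. -/
def pointMasks (m T : ℕ) : Set (Matrix (Fin m) (Fin T) ℝ) :=
  {B | ∃ (k : Fin m) (l : Fin T), B = Matrix.single k l 1}

/-- The sampling operator `A ↦ (tr(X_1'A), …, tr(X_N'A)) / √N` attached to masks `X_1, …, X_N`,
with values in Euclidean `N`-space. -/
def samplingOperator {m T N : ℕ} (X : Fin N → Matrix (Fin m) (Fin T) ℝ)
    (A : Matrix (Fin m) (Fin T) ℝ) : EuclideanSpace ℝ (Fin N) :=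
  WithLp.toLp 2 fun i => ((X i)ᵀ * A).trace / √(N : ℝ)

/-- The prediction distance `d̂_{2,N}(A, B)`: Euclidean norm of the sampling operator at `A - B`. -/
def predictionDist {m T N : ℕ} (X : Fin N → Matrix (Fin m) (Fin T) ℝ)
    (A B : Matrix (Fin m) (Fin T) ℝ) : ℝ :=
  ‖samplingOperator X (A - B)‖

/-- The penalized least squares criterion
`(1/N) ∑ᵢ (yᵢ - tr(Xᵢ'A))² + lam ‖A‖_{S_p}^p`. -/
def schattenCriterion {m T N : ℕ} (p lam : ℝ) (X : Fin N → Matrix (Fin m) (Fin T) ℝ)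
    (y : Fin N → ℝ) (A : Matrix (Fin m) (Fin T) ℝ) : ℝ :=
  1 / (N : ℝ) * ∑ i, (y i - ((X i)ᵀ * A).trace) ^ 2 + lam * schattenNorm p A ^ p

/-- `Ahat` is a Schatten-`p` estimate with tuning parameter `lam` from the data `(X, y)`:
a global minimizer of the criterion over all matrices. -/
def IsSchattenEstimate {m T N : ℕ} (p lam : ℝ) (X : Fin N → Matrix (Fin m) (Fin T) ℝ)
    (y : Fin N → ℝ) (Ahat : Matrix (Fin m) (Fin T) ℝ) : Prop :=
  ∀ A, schattenCriterion p lam X y Ahat ≤ schattenCriterion p lam X y A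

/-- Matrix completion with collaborative sampling: the (possibly random) masks are almost surely
pairwise distinct point masks, and the family of masks is independent of the family of errors. -/
structure CollaborativeSampling {m T N : ℕ} {Ω : Type*} [MeasurableSpace Ω] (P : Measure Ω)
    (X : Fin N → Ω → Matrix (Fin m) (Fin T) ℝ) (ξ : Fin N → Ω → ℝ) : Prop where
  measurable_entry : ∀ i k l, Measurable fun ω => X i ω k l
  mem_pointMasks : ∀ i, ∀ᵐ ω ∂P, X i ω ∈ pointMasks m T
  distinct : ∀ i j, i ≠ j → ∀ᵐ ω ∂P, X i ω ≠ X j ω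
  indep : IndepFun (fun ω (a : Fin N × Fin m × Fin T) => X a.1 ω a.2.1 a.2.2)
    (fun ω i => ξ i ω) P

/-- Independent identically distributed real random variables. -/
structure IsIID {N : ℕ} {Ω : Type*} [MeasurableSpace Ω] (P : Measure Ω)
    (ξ : Fin N → Ω → ℝ) : Prop where
  measurable : ∀ i, Measurable (ξ i)
  indep : iIndepFun ξ P
  identDistrib : ∀ i j, IdentDistrib (ξ i) (ξ j) P P

/-- The Bernstein condition `max_i E|ξ_i|^l ≤ (1/2) l! σ² H^{l-2}`, `l = 2, 3, …`. -/
def BernsteinCondition {N : ℕ} {Ω : Type*} [MeasurableSpace Ω] (P : Measure Ω)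
    (σ H : ℝ) (ξ : Fin N → Ω → ℝ) : Prop :=
  ∀ i, ∀ l : ℕ, 2 ≤ l → Integrable (fun ω => |ξ i ω| ^ l) P ∧
    ∫ ω, |ξ i ω| ^ l ∂P ≤ 1 / 2 * (l.factorial : ℝ) * σ ^ 2 * H ^ (l - 2)

/-- The effective noise level for Gaussian errors: `8 σ √D √(m+T) / N`. -/
def gaussianLevel (m T N : ℕ) (σ D : ℝ) : ℝ :=
  8 * σ * √D * (√((m : ℝ) + T) / N)

/-- The effective noise level for Bernstein errors: `(4 σ √(2D(m+T)) + 8 H D (m+T)) / N`. -/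
def bernsteinLevel (m T N : ℕ) (σ H D : ℝ) : ℝ :=
  (4 * σ * √(2 * D * ((m : ℝ) + T)) + 8 * H * D * ((m : ℝ) + T)) / N

/-- The property `Q` holds with probability at least `q`: it holds on a measurable event of
probability at least `q`. (No measurability of `{ω | Q ω}` itself is presupposed.) -/
def HoldsWithProbAtLeast {Ω : Type*} [MeasurableSpace Ω] (P : Measure Ω) (q : ℝ)
    (Q : Ω → Prop) : Prop :=
  ∃ E : Set Ω, MeasurableSet E ∧ q ≤ P.real E ∧ ∀ ω ∈ E, Q ω

end TraceRegression

end

/-! Put W = ∑ ξ_i X_i. Comparing the criterion at Â and A* gives d̂² ≤ (2/N) tr(W'(Â - A*)) +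
λ(‖A*‖₁ - ‖Â‖₁). If (2/N)‖W‖_op ≤ λ, trace duality bounds the noise term by λ(‖Â‖₁ + ‖A*‖₁), so d̂²
≤ 2λ‖A*‖₁ (`sq_predictionDist_le_of_opNorm_le`).

It remains to bound ‖W‖_op. Up to a factor 4 it is the maximum of |u'Wv| over 1/2-nets of the two
unit balls, at most 5^(m+T) pairs. Since the masks occupy distinct positions, u'Wv is a weighted sum
of the errors with ∑ a_i² ≤ ‖u‖²‖v‖² ≤ 1, so Bernstein's inequality and a union bound apply.
Gaussian errors are the case H = 0. Random masks take finitely many values and are independent of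
the errors, so a bound uniform over mask patterns suffices
(`le_measureReal_iUnion_inter_of_indepFun`). -/

namespace TraceRegression

/-! ### Nets and the operator norm -/

/-- The closed unit ball of a `d`-dimensional normed space has a `1/2`-net of at most `5 ^ d`
points. -/
theorem exists_half_net (E : Type*) [NormedAddCommGroup E] [NormedSpace ℝ E]
    [FiniteDimensional ℝ E] :
    ∃ S : Finset E, S.card ≤ 5 ^ Module.finrank ℝ E ∧ (∀ s ∈ S, ‖s‖ ≤ 1) ∧
      ∀ x : E, ‖x‖ ≤ 1 → ∃ s ∈ S, ‖x - s‖ ≤ 1 / 2 := by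
  classical
  let good : Finset E → Prop := fun S =>
    (∀ s ∈ S, ‖s‖ ≤ 1) ∧ ∀ s ∈ S, ∀ t ∈ S, s ≠ t → 1 / 2 ≤ ‖s - t‖
  have hcard : ∀ S, good S → S.card ≤ 5 ^ Module.finrank ℝ E := by
    intro S hS
    -- Doubling turns a 1/2-separated set in the unit ball into a 1-separated set in the ball of
    -- radius 2, the normalisation of the Besicovitch count.
    have hinj : Function.Injective fun x : E => (2 : ℝ) • x :=
      smul_right_injective E two_ne_zero
    rw [← Finset.card_image_of_injective S hinj]
    apply Besicovitch.card_le_of_separated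
    · simp only [Finset.mem_image, forall_exists_index, and_imp, forall_apply_eq_imp_iff₂]
      intro s hs
      rw [norm_smul, Real.norm_ofNat]
      linarith [hS.1 s hs]
    · simp only [Finset.mem_image, forall_exists_index, and_imp, forall_apply_eq_imp_iff₂]
      intro s hs t ht hst
      rw [← smul_sub, norm_smul, Real.norm_ofNat]
      have := hS.2 s hs t ht fun h => hst (by rw [h])
      linarith
  let cards : Set ℕ := {n | ∃ S, good S ∧ S.card = n}
  have hne : cards.Nonempty := ⟨0, ∅, ⟨by simp, by simp⟩, rfl⟩
  have hbdd : BddAbove cards := ⟨5 ^ Module.finrank ℝ E, by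
    rintro n ⟨S, hS, rfl⟩
    exact hcard S hS⟩
  obtain ⟨S, hS, hSc⟩ := Nat.sSup_mem hne hbdd
  refine ⟨S, hcard S hS, hS.1, fun x hx => ?_⟩
  -- A point far from all of S could be added to S, against the maximality of its cardinality.
  by_contra! hfar
  have hxS : x ∉ S := fun h => by
    have := hfar x h
    norm_num at this
  have hgood : good (insert x S) := by
    refine ⟨?_, ?_⟩
    · intro s hs
      rcases Finset.mem_insert.1 hs with rfl | hs
      exacts [hx, hS.1 s hs]
    · intro s hs t ht hst
      rcases Finset.mem_insert.1 hs with rfl | hsS <;>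
        rcases Finset.mem_insert.1 ht with rfl | htS
      · exact absurd rfl hst
      · exact (hfar t htS).le
      · rw [norm_sub_rev]
        exact (hfar s hsS).le
      · exact hS.2 s hsS t htS hst
  have := le_csSup hbdd ⟨_, hgood, rfl⟩
  rw [Finset.card_insert_of_notMem hxS, ← hSc] at this
  omega

/-- The operator norm is at most twice the supremum over a `1/2`-net of the unit ball. -/
theorem opNorm_le_of_half_net {E F : Type*} [NormedAddCommGroup E] [NormedSpace ℝ E]
    [NormedAddCommGroup F] [NormedSpace ℝ F] (g : E →L[ℝ] F) {S : Finset E} {c : ℝ}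
    (hS : ∀ x : E, ‖x‖ ≤ 1 → ∃ s ∈ S, ‖x - s‖ ≤ 1 / 2) (hg : ∀ s ∈ S, ‖g s‖ ≤ c) :
    ‖g‖ ≤ 2 * c := by
  obtain ⟨s₀, hs₀, -⟩ := hS 0 (by simp)
  have hc : 0 ≤ c := (norm_nonneg _).trans (hg s₀ hs₀)
  have : ‖g‖ ≤ c + ‖g‖ / 2 := by
    refine g.opNorm_le_of_unit_norm (by positivity) fun x hx => ?_
    obtain ⟨s, hs, hxs⟩ := hS x hx.le
    calc ‖g x‖ = ‖g s + g (x - s)‖ := by rw [← map_add]; congr 2; abel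
      _ ≤ ‖g s‖ + ‖g (x - s)‖ := norm_add_le _ _
      _ ≤ c + ‖g‖ * (1 / 2) := add_le_add (hg s hs) (g.le_opNorm_of_le hxs)
      _ = c + ‖g‖ / 2 := by ring
  linarith

/-- A bilinear form bounded by `c` on `1/2`-nets of both unit balls has operator norm at most
`4 * c`. -/
theorem opNorm_le_of_half_nets {E F : Type*} [NormedAddCommGroup E] [InnerProductSpace ℝ E]
    [NormedAddCommGroup F] [InnerProductSpace ℝ F] (g : E →L[ℝ] F) {S : Finset E} {S' : Finset F}
    {c : ℝ} (hS : ∀ x : E, ‖x‖ ≤ 1 → ∃ s ∈ S, ‖x - s‖ ≤ 1 / 2)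
    (hS' : ∀ x : F, ‖x‖ ≤ 1 → ∃ s ∈ S', ‖x - s‖ ≤ 1 / 2)
    (hg : ∀ v ∈ S, ∀ u ∈ S', |inner ℝ (g v) u| ≤ c) : ‖g‖ ≤ 4 * c := by
  have : ‖g‖ ≤ 2 * (2 * c) := by
    refine opNorm_le_of_half_net g hS fun v hv => ?_
    rw [← innerSL_apply_norm (𝕜 := ℝ) (g v)]
    exact opNorm_le_of_half_net _ hS' fun u hu => by simpa using hg v hv u hu
  linarith

/-! ### Trace duality and the oracle inequality -/

/-- The Schatten-`1` norm is the sum of the norms of the images of an orthonormal basis. -/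
theorem exists_orthonormalBasis_schattenNorm_one {m T : ℕ} (B : Matrix (Fin m) (Fin T) ℝ) :
    ∃ b : OrthonormalBasis (Fin T) ℝ (EuclideanSpace ℝ (Fin T)),
      schattenNorm 1 B = ∑ j, ‖Matrix.toEuclideanLin B (b j)‖ := by
  set f := Matrix.toEuclideanLin B with hf
  have hn : Module.finrank ℝ (EuclideanSpace ℝ (Fin T)) = T := by simp
  -- Right singular vectors: ‖f b_j‖² = ⟨f*f b_j, b_j⟩ = σ_j².
  refine ⟨f.isSymmetric_adjoint_comp_self.eigenvectorBasis hn, ?_⟩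
  have hnorm : ∀ j : Fin T,
      ‖f (f.isSymmetric_adjoint_comp_self.eigenvectorBasis hn j)‖ = f.singularValues j := by
    intro j
    rw [← sq_eq_sq₀ (norm_nonneg _) (f.singularValues_nonneg _), f.sq_singularValues_fin hn,
      ← real_inner_self_eq_norm_sq, ← LinearMap.adjoint_inner_left, ← LinearMap.comp_apply,
      f.isSymmetric_adjoint_comp_self.apply_eigenvectorBasis hn j, real_inner_comm]
    simp [inner_smul_right]
  simp_rw [hnorm]
  rw [Fin.sum_univ_eq_sum_range (fun j => f.singularValues j) T]
  simp only [schattenNorm, singularValue, Real.rpow_one, div_one, ← hf]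
  -- The indices from min(m,T) up to T contribute nothing, because the rank is at most m.
  refine Finset.sum_subset (Finset.range_mono (min_le_right _ _)) fun j hj hj' => ?_
  rw [f.singularValues_eq_zero_iff_le_finrank_range]
  simp only [Finset.mem_range] at hj hj'
  have := Submodule.finrank_le f.range
  rw [finrank_euclideanSpace_fin] at this
  omega

theorem schattenNorm_one_nonneg {m T : ℕ} (B : Matrix (Fin m) (Fin T) ℝ) :
    0 ≤ schattenNorm 1 B := by
  obtain ⟨b, hb⟩ := exists_orthonormalBasis_schattenNorm_one B
  rw [hb]
  positivity

/-- Duality between the operator norm and the Schatten-`1` norm. -/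
theorem abs_trace_transpose_mul_le {m T : ℕ} (W B : Matrix (Fin m) (Fin T) ℝ) :
    |(Wᵀ * B).trace| ≤ ‖(Matrix.toEuclideanLin W).toContinuousLinearMap‖ * schattenNorm 1 B := by
  obtain ⟨b, hb⟩ := exists_orthonormalBasis_schattenNorm_one B
  -- Computing the trace in the basis adapted to B leaves only ‖W b_j‖ ≤ ‖W‖ to be used for each j.
  have htr : (Wᵀ * B).trace =
      ∑ j, inner ℝ (Matrix.toEuclideanLin W (b j)) (Matrix.toEuclideanLin B (b j)) := by
    have h1 : (Wᵀ * B).trace =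
        LinearMap.trace ℝ _ ((Matrix.toEuclideanLin W).adjoint ∘ₗ Matrix.toEuclideanLin B) := by
      rw [← Matrix.toEuclideanLin_conjTranspose_eq_adjoint,
        Matrix.conjTranspose_eq_transpose_of_trivial]
      simp only [Matrix.toLpLin_eq_toLin]
      rw [← Matrix.toLin_mul, Matrix.trace_toLin_eq]
    rw [h1, LinearMap.trace_eq_sum_inner _ b]
    simp [LinearMap.adjoint_inner_right]
  rw [htr, hb, Finset.mul_sum]
  refine (Finset.abs_sum_le_sum_abs _ _).trans (Finset.sum_le_sum fun j _ => ?_)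
  refine (abs_real_inner_le_norm _ _).trans ?_
  gcongr
  have := (Matrix.toEuclideanLin W).toContinuousLinearMap.le_opNorm (b j)
  simpa using this

theorem sq_predictionDist {m T N : ℕ} (X : Fin N → Matrix (Fin m) (Fin T) ℝ)
    (A B : Matrix (Fin m) (Fin T) ℝ) :
    predictionDist X A B ^ 2 =
      1 / (N : ℝ) * ∑ i, (((X i)ᵀ * A).trace - ((X i)ᵀ * B).trace) ^ 2 := by
  rw [predictionDist, EuclideanSpace.real_norm_sq_eq, Finset.mul_sum]
  refine Finset.sum_congr rfl fun i _ => ?_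
  simp only [samplingOperator, Matrix.mul_sub, Matrix.trace_sub]
  rw [div_pow, Real.sq_sqrt (Nat.cast_nonneg N)]
  ring

/-- Oracle inequality for the Schatten-`1` estimator when the regularization parameter dominates
the stochastic error. -/
theorem sq_predictionDist_le_of_opNorm_le {m T N : ℕ} {lam : ℝ}
    {X : Fin N → Matrix (Fin m) (Fin T) ℝ} {ξ : Fin N → ℝ} {Astar Ahat : Matrix (Fin m) (Fin T) ℝ}
    (hA : IsSchattenEstimate 1 lam X (fun i => ((X i)ᵀ * Astar).trace + ξ i) Ahat)
    (hW : 2 / N * ‖(Matrix.toEuclideanLin (∑ i, ξ i • X i)).toContinuousLinearMap‖ ≤ lam) :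
    predictionDist X Ahat Astar ^ 2 ≤ 2 * lam * schattenNorm 1 Astar := by
  set W := ∑ i, ξ i • X i with hWdef
  set w := ‖(Matrix.toEuclideanLin W).toContinuousLinearMap‖
  have htr : ∀ B : Matrix (Fin m) (Fin T) ℝ,
      (Wᵀ * B).trace = ∑ i, ξ i * ((X i)ᵀ * B).trace := by
    intro B
    simp [hWdef, Matrix.transpose_sum, Matrix.sum_mul, Matrix.trace_sum]
  have hmin := hA Astar
  simp only [schattenCriterion, Real.rpow_one, add_sub_cancel_left] at hmin
  have hexp : ∑ i, (((X i)ᵀ * Astar).trace + ξ i - ((X i)ᵀ * Ahat).trace) ^ 2 =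
      ∑ i, (((X i)ᵀ * Ahat).trace - ((X i)ᵀ * Astar).trace) ^ 2 + ∑ i, ξ i ^ 2
        - 2 * ((Wᵀ * Ahat).trace - (Wᵀ * Astar).trace) := by
    rw [htr, htr, ← Finset.sum_sub_distrib, Finset.mul_sum, ← Finset.sum_add_distrib,
      ← Finset.sum_sub_distrib]
    exact Finset.sum_congr rfl fun i _ => by ring
  rw [hexp] at hmin
  have hd := sq_predictionDist X Ahat Astar
  have h1 := (abs_le.1 (abs_trace_transpose_mul_le W Ahat)).2
  have h2 := (abs_le.1 (abs_trace_transpose_mul_le W Astar)).1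
  -- The two traces are bounded separately; the resulting λ‖Â‖₁ is exactly what the penalty cancels.
  have hbound : (2 / N : ℝ) * ((Wᵀ * Ahat).trace - (Wᵀ * Astar).trace) ≤
      lam * (schattenNorm 1 Ahat + schattenNorm 1 Astar) :=
    calc (2 / N : ℝ) * ((Wᵀ * Ahat).trace - (Wᵀ * Astar).trace)
        ≤ (2 / N : ℝ) * (w * (schattenNorm 1 Ahat + schattenNorm 1 Astar)) := by
          gcongr
          linarith
      _ = (2 / N * w) * (schattenNorm 1 Ahat + schattenNorm 1 Astar) := by ring
      _ ≤ _ := by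
          have := schattenNorm_one_nonneg Ahat
          have := schattenNorm_one_nonneg Astar
          gcongr
  have hsplit : (2 / N : ℝ) * ((Wᵀ * Ahat).trace - (Wᵀ * Astar).trace) =
      1 / N * (2 * ((Wᵀ * Ahat).trace - (Wᵀ * Astar).trace)) := by ring
  rw [mul_sub, mul_add] at hmin
  linarith

/-! ### Bernstein's inequality -/

/-- The Bernstein moment generating function bound: `E exp(tZ) ≤ exp(σ²t² / (2(1 - H|t|)))`
whenever `|t| H < 1`. -/
def HasBernsteinMGF {Ω : Type*} [MeasurableSpace Ω] (P : Measure Ω) (σ H : ℝ) (Z : Ω → ℝ) : Prop :=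
  ∀ t : ℝ, |t| * H < 1 → Integrable (fun ω => Real.exp (t * Z ω)) P ∧
    mgf Z P t ≤ Real.exp (σ ^ 2 * t ^ 2 / (2 * (1 - H * |t|)))

/-- For x ≤ 0 this is |x| ≤ sinh |x|. The linear term keeps its sign, so a zero mean removes it,
while the remainder involves only absolute moments. -/
theorem exp_le_exp_abs_sub_abs_add (x : ℝ) : Real.exp x ≤ Real.exp |x| - |x| + x := by
  rcases le_total 0 x with hx | hx
  · simp [abs_of_nonneg hx]
  · have h := Real.self_le_sinh_iff.2 (neg_nonneg.2 hx)
    rw [Real.sinh_eq, neg_neg] at h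
    rw [abs_of_nonpos hx]
    linarith

/-- In the series of E exp|tZ|, the moment condition cancels the factorials and leaves a geometric
series of ratio H|t| from l = 2 on. The terms l = 0, 1 are 1 and E|tZ|, and the latter drops out by
`exp_le_exp_abs_sub_abs_add`. -/
theorem hasBernsteinMGF_of_moments {Ω : Type*} [MeasurableSpace Ω] {P : Measure Ω}
    [IsProbabilityMeasure P] {σ H : ℝ} (hH : 0 ≤ H) {Z : Ω → ℝ} (hZ : Measurable Z)
    (hint : Integrable Z P) (hmean : ∫ ω, Z ω ∂P = 0)
    (hmom : ∀ l : ℕ, 2 ≤ l → Integrable (fun ω => |Z ω| ^ l) P ∧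
      ∫ ω, |Z ω| ^ l ∂P ≤ 1 / 2 * (l.factorial : ℝ) * σ ^ 2 * H ^ (l - 2)) :
    HasBernsteinMGF P σ H Z := by
  intro t ht
  have hpow : ∀ l : ℕ, Integrable (fun ω => |Z ω| ^ l) P := by
    intro l
    match l with
    | 0 => simp
    | 1 => simpa using hint.abs
    | l + 2 => exact (hmom (l + 2) (by omega)).1
  let F : ℕ → Ω → ℝ := fun l ω => |t * Z ω| ^ l / l.factorial
  have hFeq : ∀ l, F l = fun ω => |t| ^ l / l.factorial * |Z ω| ^ l := by
    intro l
    funext ω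
    simp only [F, abs_mul, mul_pow]
    ring
  have hFint : ∀ l, Integrable (F l) P := fun l => by
    rw [hFeq]
    exact (hpow l).const_mul _
  have hF0 : ∀ l ω, 0 ≤ F l ω := fun l ω => by positivity
  have hr0 : 0 ≤ H * |t| := by positivity
  have hr1 : H * |t| < 1 := by rwa [mul_comm]
  have hbound : ∀ l, ∫ ω, F (l + 2) ω ∂P ≤ σ ^ 2 * t ^ 2 / 2 * (H * |t|) ^ l := by
    intro l
    rw [hFeq, integral_const_mul]
    have h := (hmom (l + 2) (by omega)).2
    rw [Nat.add_sub_cancel] at h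
    have hfac : ((l + 2).factorial : ℝ) ≠ 0 := by positivity
    calc |t| ^ (l + 2) / ((l + 2).factorial : ℝ) * ∫ ω, |Z ω| ^ (l + 2) ∂P
        ≤ |t| ^ (l + 2) / ((l + 2).factorial : ℝ) *
          (1 / 2 * ((l + 2).factorial : ℝ) * σ ^ 2 * H ^ l) := by gcongr
      _ = σ ^ 2 * |t| ^ 2 / 2 * (H * |t|) ^ l := by
        rw [mul_pow, pow_add]
        field_simp
      _ = _ := by rw [sq_abs]
  have hgeo := (hasSum_geometric_of_lt_one hr0 hr1).mul_left (σ ^ 2 * t ^ 2 / 2)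
  have hsum2 : Summable fun l => ∫ ω, F (l + 2) ω ∂P :=
    Summable.of_nonneg_of_le (fun l => integral_nonneg (hF0 _)) hbound hgeo.summable
  have hsum : Summable fun l => ∫ ω, F l ω ∂P := (summable_nat_add_iff 2).1 hsum2
  have hnormsum : Summable fun l => ∫ ω, ‖F l ω‖ ∂P := by
    simpa only [Real.norm_eq_abs, abs_of_nonneg (hF0 _ _)] using hsum
  have hHas := hasSum_integral_of_summable_integral_norm hFint hnormsum
  have hexp : ∀ ω, ∑' l, F l ω = Real.exp |t * Z ω| := fun ω => by
    rw [Real.exp_eq_exp_ℝ, NormedSpace.exp_eq_tsum_div]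
  simp only [hexp] at hHas
  have hval : ∫ ω, Real.exp |t * Z ω| ∂P ≤
      1 + ∫ ω, |t * Z ω| ∂P + σ ^ 2 * t ^ 2 / (2 * (1 - H * |t|)) := by
    rw [← hHas.tsum_eq, ← hsum.sum_add_tsum_nat_add 2]
    have h2 := hsum2.tsum_le_tsum hbound hgeo.summable
    rw [hgeo.tsum_eq] at h2
    have h3 : σ ^ 2 * t ^ 2 / 2 * (1 - H * |t|)⁻¹ = σ ^ 2 * t ^ 2 / (2 * (1 - H * |t|)) := by
      rw [div_mul_eq_div_div]
      rfl
    rw [h3] at h2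
    simpa [Finset.sum_range_succ, F] using h2
  -- A nonintegrable function has integral 0 by convention, so this lower bound forces
  -- integrability.
  have hpos : (1 : ℝ) ≤ ∫ ω, Real.exp |t * Z ω| ∂P := by
    rw [← hHas.tsum_eq]
    have := hsum.le_tsum 0 fun l _ => integral_nonneg (hF0 l)
    simpa [F] using this
  have hexpint : Integrable (fun ω => Real.exp |t * Z ω|) P := by
    by_contra hcon
    rw [integral_undef hcon] at hpos
    linarith
  have hZt : Integrable (fun ω => t * Z ω) P := hint.const_mul t
  have hEint : Integrable (fun ω => Real.exp (t * Z ω)) P := by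
    refine hexpint.mono' (by fun_prop) (Filter.Eventually.of_forall fun ω => ?_)
    rw [Real.norm_eq_abs, Real.abs_exp]
    exact Real.exp_le_exp.2 (le_abs_self _)
  refine ⟨hEint, ?_⟩
  calc mgf Z P t = ∫ ω, Real.exp (t * Z ω) ∂P := rfl
    _ ≤ ∫ ω, (Real.exp |t * Z ω| - |t * Z ω| + t * Z ω) ∂P :=
      integral_mono hEint ((hexpint.sub hZt.abs).add hZt) fun ω => exp_le_exp_abs_sub_abs_add _
    _ = (∫ ω, Real.exp |t * Z ω| ∂P) - ∫ ω, |t * Z ω| ∂P := by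
      have h1 := integral_add (hexpint.sub hZt.abs) hZt
      have h2 := integral_sub hexpint hZt.abs
      simp only [Pi.sub_apply] at h1 h2
      rw [h1, h2, integral_const_mul, hmean, mul_zero, add_zero]
    _ ≤ σ ^ 2 * t ^ 2 / (2 * (1 - H * |t|)) + 1 := by linarith
    _ ≤ _ := Real.add_one_le_exp _

theorem hasBernsteinMGF_of_gaussian {Ω : Type*} [MeasurableSpace Ω] {P : Measure Ω} {σ : ℝ}
    {Z : Ω → ℝ} (hZ : HasLaw Z (gaussianReal 0 (σ ^ 2).toNNReal) P) :
    HasBernsteinMGF P σ 0 Z := by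
  intro t _
  have hmgf := mgf_gaussianReal hZ.map_eq t
  refine ⟨?_, ?_⟩
  · have h := integrable_exp_mul_gaussianReal (μ := 0) (v := (σ ^ 2).toNNReal) t
    rw [← hZ.map_eq] at h
    exact h.comp_aemeasurable hZ.aemeasurable
  · rw [hmgf, Real.coe_toNNReal _ (sq_nonneg σ)]
    simp

/-- This t makes the Chernoff exponent equal to -x exactly at the threshold σ√(2x) + Hx. Here 1 - Ht
= σ/(σ + H√(2x)), which is positive because σ > 0. -/
theorem bernstein_exponent_eq {σ H x : ℝ} (hσ : 0 < σ) (hH : 0 ≤ H) (hx : 0 ≤ x) :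
    let t := √(2 * x) / (σ + H * √(2 * x))
    0 ≤ t ∧ t * H < 1 ∧
      -t * (σ * √(2 * x) + H * x) + σ ^ 2 * t ^ 2 / (2 * (1 - H * t)) = -x := by
  intro t
  obtain ⟨q, hq⟩ : ∃ q, √(2 * x) = q := ⟨_, rfl⟩
  have hq0 : 0 ≤ q := hq ▸ Real.sqrt_nonneg _
  have hxq : x = q ^ 2 / 2 := by
    rw [← hq, Real.sq_sqrt (by positivity)]
    ring
  have hden : 0 < σ + H * q := by positivity
  have ht : t = q / (σ + H * q) := by simp only [t, hq]
  have h1 : 1 - H * t = σ / (σ + H * q) := by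
    rw [ht]
    field_simp
    ring
  refine ⟨by rw [ht]; positivity, ?_, ?_⟩
  · have : 0 < σ / (σ + H * q) := by positivity
    linarith
  · rw [h1, ht, hq, hxq]
    field_simp
    ring

/-- Bernstein's inequality for weighted sums with weights in the Euclidean unit ball. -/
theorem measureReal_le_weighted_sum_le {ι Ω : Type*} [Fintype ι] [MeasurableSpace Ω]
    {P : Measure Ω} [IsProbabilityMeasure P] {σ H x : ℝ} (hσ : 0 < σ) (hH : 0 ≤ H) (hx : 0 ≤ x)
    {ξ : ι → Ω → ℝ} (hmeas : ∀ i, Measurable (ξ i)) (hindep : iIndepFun ξ P)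
    (hmgf : ∀ i, HasBernsteinMGF P σ H (ξ i)) {a : ι → ℝ} (ha : ∑ i, a i ^ 2 ≤ 1) :
    P.real {ω | σ * √(2 * x) + H * x ≤ ∑ i, a i * ξ i ω} ≤ Real.exp (-x) := by
  obtain ⟨ht0, htH, hexp⟩ := bernstein_exponent_eq hσ hH hx
  set t := √(2 * x) / (σ + H * √(2 * x))
  have ha1 : ∀ i, |a i| ≤ 1 := fun i =>
    abs_le_one_iff_mul_self_le_one.2 <| by
      rw [← sq]
      exact (Finset.single_le_sum (fun j _ => sq_nonneg (a j)) (Finset.mem_univ i)).trans ha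
  let V : ι → Ω → ℝ := fun i ω => a i * ξ i ω
  have hVmeas : ∀ i, Measurable (V i) := fun i => (hmeas i).const_mul _
  have hVindep : iIndepFun V P :=
    hindep.comp (fun i y => a i * y) fun i => measurable_const_mul _
  have hat : ∀ i, |a i * t| ≤ t := fun i => by
    rw [abs_mul, abs_of_nonneg ht0]
    exact mul_le_of_le_one_left ht0 (ha1 i)
  have hat' : ∀ i, |a i * t| * H < 1 := fun i =>
    (mul_le_mul_of_nonneg_right (hat i) hH).trans_lt htH
  have hVint : ∀ i, Integrable (fun ω => Real.exp (t * V i ω)) P := fun i => by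
    have h := (hmgf i _ (hat' i)).1
    have heq : ∀ ω, t * V i ω = a i * t * ξ i ω := fun ω => by simp only [V]; ring
    simpa only [heq] using h
  have hpos : 0 < 1 - H * t := by linarith
  have hVmgf : ∀ i, mgf (V i) P t ≤ Real.exp (a i ^ 2 * (σ ^ 2 * t ^ 2 / (2 * (1 - H * t)))) := by
    intro i
    have h := (hmgf i _ (hat' i)).2
    rw [show mgf (V i) P t = mgf (ξ i) P (a i * t) from mgf_const_mul (a i)]
    refine h.trans (Real.exp_le_exp.2 ?_)
    -- With a denominator free of i, the exponent is proportional to a_i², so the product over i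
    -- only sees ∑ a_i² ≤ 1.
    have hle : σ ^ 2 * (a i * t) ^ 2 / (2 * (1 - H * |a i * t|)) ≤
        σ ^ 2 * (a i * t) ^ 2 / (2 * (1 - H * t)) := by
      gcongr
      exact hat i
    refine hle.trans_eq ?_
    ring
  have hsumeq : ∀ ω, ∑ i, a i * ξ i ω = (∑ i, V i) ω := fun ω => by simp [V]
  simp only [hsumeq]
  refine (measure_ge_le_exp_mul_mgf _ ht0
    (hVindep.integrable_exp_mul_sum hVmeas fun i _ => hVint i)).trans ?_
  rw [hVindep.mgf_sum hVmeas]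
  calc Real.exp (-t * (σ * √(2 * x) + H * x)) * ∏ i, mgf (V i) P t
      ≤ Real.exp (-t * (σ * √(2 * x) + H * x)) *
        ∏ i, Real.exp (a i ^ 2 * (σ ^ 2 * t ^ 2 / (2 * (1 - H * t)))) := by
        gcongr with i
        · exact fun i _ => mgf_nonneg
        · exact hVmgf i
    _ = Real.exp (-t * (σ * √(2 * x) + H * x) +
        (∑ i, a i ^ 2) * (σ ^ 2 * t ^ 2 / (2 * (1 - H * t)))) := by
        rw [← Real.exp_sum, ← Real.exp_add, Finset.sum_mul]
    _ ≤ Real.exp (-t * (σ * √(2 * x) + H * x) + 1 * (σ ^ 2 * t ^ 2 / (2 * (1 - H * t)))) := by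
        gcongr
    _ = Real.exp (-x) := by rw [one_mul, hexp]

/-- Two-sided version, which also covers errors that vanish almost surely. -/
theorem measureReal_lt_abs_weighted_sum_le {ι Ω : Type*} [Fintype ι] [MeasurableSpace Ω]
    {P : Measure Ω} [IsProbabilityMeasure P] {σ H x : ℝ} (hσ : 0 ≤ σ) (hH : 0 ≤ H) (hx : 0 ≤ x)
    {ξ : ι → Ω → ℝ} (hmeas : ∀ i, Measurable (ξ i)) (hindep : iIndepFun ξ P)
    (hmgf : ∀ i, HasBernsteinMGF P σ H (ξ i)) (hzero : σ = 0 → ∀ i, ξ i =ᵐ[P] 0)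
    {a : ι → ℝ} (ha : ∑ i, a i ^ 2 ≤ 1) :
    P.real {ω | σ * √(2 * x) + H * x < |∑ i, a i * ξ i ω|} ≤ 2 * Real.exp (-x) := by
  rcases hσ.eq_or_lt with h0 | hσ
  · have hae : ∀ᵐ ω ∂P, ∀ i, ξ i ω = 0 := ae_all_iff.2 (hzero h0.symm)
    have hnull : P.real {ω | σ * √(2 * x) + H * x < |∑ i, a i * ξ i ω|} = 0 := by
      rw [measureReal_eq_zero_iff]
      refine measure_mono_null ?_ (ae_iff.1 hae)
      intro ω hω h
      simp only [Set.mem_ofPred_eq, h, mul_zero, Finset.sum_const_zero, abs_zero, ← h0,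
        zero_mul, zero_add] at hω
      exact absurd hω (not_lt.2 (by positivity))
    rw [hnull]
    positivity
  · have hp := measureReal_le_weighted_sum_le hσ hH hx hmeas hindep hmgf ha
    have hn := measureReal_le_weighted_sum_le hσ hH hx hmeas hindep hmgf
      (a := fun i => -a i) (by simpa using ha)
    rw [two_mul (Real.exp _)]
    refine le_trans ?_ ((measureReal_union_le _ _).trans (add_le_add hp hn))
    refine measureReal_mono ?_
    intro ω hω
    simp only [Set.mem_ofPred_eq, Set.mem_union, neg_mul, Finset.sum_neg_distrib] at hω ⊢
    rcases lt_abs.1 hω with h | h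
    exacts [Or.inl h.le, Or.inr h.le]

/-! ### Conditioning on the masks -/

/-- If `Z` is independent of `ξ` and almost surely takes values in a finite family `z k`, and each
event `ξ ∈ G k` has probability at least `q`, then `ξ` lies in the event indexed by `Z` with
probability at least `q`. -/
theorem le_measureReal_iUnion_inter_of_indepFun {Ω α β κ : Type*} [MeasurableSpace Ω]
    [MeasurableSpace α] [MeasurableSingletonClass α] [MeasurableSpace β]
    {P : Measure Ω} [IsProbabilityMeasure P] {Z : Ω → α} {ξ : Ω → β} (hZ : Measurable Z)
    (hξ : Measurable ξ) (hind : IndepFun Z ξ P) {K : Finset κ} {z : κ → α}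
    (hz : Function.Injective z) (hcover : ∀ᵐ ω ∂P, ∃ k ∈ K, Z ω = z k) {G : κ → Set β}
    (hGm : ∀ k, MeasurableSet (G k)) {q : ℝ} (hG : ∀ k ∈ K, q ≤ P.real (ξ ⁻¹' G k)) :
    q ≤ P.real (⋃ k ∈ K, Z ⁻¹' {z k} ∩ ξ ⁻¹' G k) := by
  have hCm : ∀ k, MeasurableSet (Z ⁻¹' {z k}) := fun k => hZ (measurableSet_singleton _)
  have hdisj : (K : Set κ).PairwiseDisjoint fun k => Z ⁻¹' {z k} := by
    intro k _ k' _ hkk'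
    exact Disjoint.preimage _ (Set.disjoint_singleton.2 fun h => hkk' (hz h))
  have hone : ∑ k ∈ K, P.real (Z ⁻¹' {z k}) = 1 := by
    rw [← measureReal_biUnion_finset hdisj fun k _ => hCm k, measureReal_def,
      (prob_compl_eq_zero_iff (Finset.measurableSet_biUnion _ fun k _ => hCm k)).1 ?_]
    · simp
    · refine measure_mono_null ?_ (ae_iff.1 hcover)
      rintro ω hω ⟨k, hk, hkω⟩
      exact hω (Set.mem_biUnion hk hkω)
  rw [measureReal_biUnion_finset (fun k hk k' hk' hne =>
      (hdisj hk hk' hne).mono Set.inter_subset_left Set.inter_subset_left)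
      fun k _ => (hCm k).inter (hξ (hGm k))]
  calc q = ∑ k ∈ K, P.real (Z ⁻¹' {z k}) * q := by rw [← Finset.sum_mul, hone, one_mul]
    _ ≤ ∑ k ∈ K, P.real (Z ⁻¹' {z k}) * P.real (ξ ⁻¹' G k) :=
      Finset.sum_le_sum fun k hk => mul_le_mul_of_nonneg_left (hG k hk) measureReal_nonneg
    _ = ∑ k ∈ K, P.real (Z ⁻¹' {z k} ∩ ξ ⁻¹' G k) := by
      refine Finset.sum_congr rfl fun k _ => ?_
      rw [measureReal_def, measureReal_def, measureReal_def,
        hind.measure_inter_preimage_eq_mul _ _ (measurableSet_singleton _) (hGm k),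
        ENNReal.toReal_mul]

/-- The weights `u_k v_l` along distinct positions form a vector of norm at most `1`. -/
theorem sum_sq_weights_le_one {m T N : ℕ} {κ : Fin N → Fin m × Fin T}
    (hκ : Function.Injective κ) {u : EuclideanSpace ℝ (Fin m)} {v : EuclideanSpace ℝ (Fin T)}
    (hu : ‖u‖ ≤ 1) (hv : ‖v‖ ≤ 1) : ∑ i, (u (κ i).1 * v (κ i).2) ^ 2 ≤ 1 := by
  classical
  calc ∑ i, (u (κ i).1 * v (κ i).2) ^ 2
      = ∑ a ∈ Finset.univ.map ⟨κ, hκ⟩, (u a.1 * v a.2) ^ 2 := by simp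
    -- Distinct positions make this a subsum of the full double sum, which factorises.
    _ ≤ ∑ a : Fin m × Fin T, (u a.1 * v a.2) ^ 2 :=
      Finset.sum_le_sum_of_subset_of_nonneg (Finset.subset_univ _) fun _ _ _ => sq_nonneg _
    _ = ‖u‖ ^ 2 * ‖v‖ ^ 2 := by
      rw [EuclideanSpace.real_norm_sq_eq, EuclideanSpace.real_norm_sq_eq, Finset.sum_mul_sum,
        Fintype.sum_prod_type]
      simp only [mul_pow]
    _ ≤ 1 := mul_le_one₀ (pow_le_one₀ (norm_nonneg _) hu) (by positivity)
      (pow_le_one₀ (norm_nonneg _) hv)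

theorem inner_toEuclideanLin_sum_smul_single {m T N : ℕ} (κ : Fin N → Fin m × Fin T)
    (ξ : Fin N → ℝ) (u : EuclideanSpace ℝ (Fin m)) (v : EuclideanSpace ℝ (Fin T)) :
    inner ℝ (Matrix.toEuclideanLin (∑ i, ξ i • Matrix.single (κ i).1 (κ i).2 (1 : ℝ)) v) u =
      ∑ i, u (κ i).1 * v (κ i).2 * ξ i := by
  rw [map_sum, LinearMap.sum_apply, sum_inner]
  refine Finset.sum_congr rfl fun i _ => ?_
  rw [map_smul, LinearMap.smul_apply, real_inner_smul_left, PiLp.inner_apply]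
  have h : ∀ k, Matrix.toEuclideanLin (Matrix.single (κ i).1 (κ i).2 (1 : ℝ)) v k =
      if k = (κ i).1 then v (κ i).2 else 0 := by
    intro k
    rw [Matrix.toLpLin_apply]
    simp [Matrix.single_mulVec, Function.update_apply]
  simp only [h]
  simp
  ring

theorem exists_pos_of_pointMasks {m T N : ℕ} {X : Fin N → Matrix (Fin m) (Fin T) ℝ}
    (hmem : ∀ i, X i ∈ pointMasks m T) (hdist : ∀ i j, i ≠ j → X i ≠ X j) :
    ∃ κ : Fin N → Fin m × Fin T, Function.Injective κ ∧
      ∀ i, X i = Matrix.single (κ i).1 (κ i).2 1 := by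
  choose k l hkl using hmem
  refine ⟨fun i => (k i, l i), fun i j hij => ?_, hkl⟩
  by_contra hne
  rw [Prod.mk.injEq] at hij
  exact hdist i j hne (by rw [hkl i, hkl j, hij.1, hij.2])

/-! ### Union bound and noise level -/

/-- With `s` the Bernstein threshold, all bilinear forms of the noise on a pair of `1/2`-nets are
simultaneously at most `s` with the stated probability. -/
theorem le_measureReal_forall_net_abs_le {m T N : ℕ} {Ω : Type*} [MeasurableSpace Ω]
    {P : Measure Ω} [IsProbabilityMeasure P] {ξ : Fin N → Ω → ℝ} {D σ H s : ℝ} (hD : 0 ≤ D)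
    (hσ : 0 ≤ σ) (hH : 0 ≤ H)
    (hs : s = 2 * σ * √(2 * D * ((m : ℝ) + T)) + 4 * H * D * ((m : ℝ) + T))
    (hmeas : ∀ i, Measurable (ξ i)) (hindep : iIndepFun ξ P)
    (hmgf : ∀ i, HasBernsteinMGF P σ H (ξ i)) (hzero : σ = 0 → ∀ i, ξ i =ᵐ[P] 0)
    {κ : Fin N → Fin m × Fin T} (hκ : Function.Injective κ)
    {S : Finset (EuclideanSpace ℝ (Fin T))} {S' : Finset (EuclideanSpace ℝ (Fin m))}
    (hS : S.card ≤ 5 ^ T) (hS' : S'.card ≤ 5 ^ m) (hS1 : ∀ v ∈ S, ‖v‖ ≤ 1)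
    (hS'1 : ∀ u ∈ S', ‖u‖ ≤ 1) :
    1 - 2 * Real.exp (-((D - Real.log 5) * ((m : ℝ) + T))) ≤
      P.real {ω | ∀ v ∈ S, ∀ u ∈ S', |∑ i, u (κ i).1 * v (κ i).2 * ξ i ω| ≤ s} := by
  -- The factor 4 is chosen so that the threshold at x is s, and (2/N)·4s is four times
  -- `bernsteinLevel`.
  set x : ℝ := 4 * (D * ((m : ℝ) + T)) with hx
  have hx0 : 0 ≤ x := by positivity
  have hsx : s = σ * √(2 * x) + H * x := by
    have : √(2 * x) = 2 * √(2 * D * ((m : ℝ) + T)) := by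
      rw [show 2 * x = 2 ^ 2 * (2 * D * ((m : ℝ) + T)) by rw [hx]; ring,
        Real.sqrt_mul (by norm_num), Real.sqrt_sq (by norm_num)]
    rw [this, hs, hx]
    ring
  have hm : MeasurableSet {ω | ∀ v ∈ S, ∀ u ∈ S', |∑ i, u (κ i).1 * v (κ i).2 * ξ i ω| ≤ s} := by
    simp only [Set.ofPred_forall]
    refine Finset.measurableSet_biInter _ fun v _ => Finset.measurableSet_biInter _ fun u _ => ?_
    exact measurableSet_le (by fun_prop) measurable_const
  have hcompl : P.real {ω | ∀ v ∈ S, ∀ u ∈ S', |∑ i, u (κ i).1 * v (κ i).2 * ξ i ω| ≤ s}ᶜ ≤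
      2 * Real.exp (-((D - Real.log 5) * ((m : ℝ) + T))) := by
    calc P.real {ω | ∀ v ∈ S, ∀ u ∈ S', |∑ i, u (κ i).1 * v (κ i).2 * ξ i ω| ≤ s}ᶜ
        ≤ P.real (⋃ p ∈ S ×ˢ S', {ω | s < |∑ i, p.2 (κ i).1 * p.1 (κ i).2 * ξ i ω|}) := by
          refine measureReal_mono (fun ω hω => ?_) (measure_ne_top P _)
          simp only [Set.mem_compl_iff, Set.mem_ofPred_eq] at hω
          push Not at hω
          obtain ⟨v, hv, u, hu, h⟩ := hω
          exact Set.mem_biUnion (x := (v, u)) (Finset.mem_product.2 ⟨hv, hu⟩) h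
      _ ≤ ∑ p ∈ S ×ˢ S', P.real {ω | s < |∑ i, p.2 (κ i).1 * p.1 (κ i).2 * ξ i ω|} :=
          measureReal_biUnion_finset_le _ _
      _ ≤ ∑ p ∈ S ×ˢ S', 2 * Real.exp (-x) := by
          refine Finset.sum_le_sum fun p hp => ?_
          rw [Finset.mem_product] at hp
          rw [hsx]
          exact measureReal_lt_abs_weighted_sum_le hσ hH hx0 hmeas hindep hmgf hzero
            (sum_sq_weights_le_one hκ (hS'1 _ hp.2) (hS1 _ hp.1))
      _ = (S.card * S'.card : ℝ) * (2 * Real.exp (-x)) := by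
          rw [Finset.sum_const, Finset.card_product, nsmul_eq_mul]
          push_cast
          rfl
      _ ≤ (5 ^ T * 5 ^ m : ℝ) * (2 * Real.exp (-x)) := by
          gcongr
          · exact_mod_cast hS
          · exact_mod_cast hS'
      _ = 2 * Real.exp (Real.log 5 * ((m : ℝ) + T) - x) := by
          rw [← pow_add, sub_eq_add_neg, Real.exp_add, ← Real.rpow_def_of_pos (by norm_num),
            ← Nat.cast_add, Real.rpow_natCast, add_comm T m]
          ring
      -- The exponent 4D is weakened to D.
      _ ≤ 2 * Real.exp (-((D - Real.log 5) * ((m : ℝ) + T))) := by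
          have : 0 ≤ D * ((m : ℝ) + T) := by positivity
          gcongr
          rw [hx]
          linarith
  rw [probReal_compl_eq_one_sub hm] at hcompl
  linarith

/-- Prediction error bound for the Schatten-`1` estimator under collaborative sampling, for errors
with Bernstein-type moment generating functions. -/
theorem holdsWithProb_of_hasBernsteinMGF {m T N : ℕ} (hN : 0 < N)
    {Ω : Type*} [MeasurableSpace Ω] {P : Measure Ω} [IsProbabilityMeasure P]
    {Astar : Matrix (Fin m) (Fin T) ℝ}
    {X : Fin N → Ω → Matrix (Fin m) (Fin T) ℝ} {ξ Y : Fin N → Ω → ℝ}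
    (hX : CollaborativeSampling P X ξ)
    (hY : ∀ i ω, Y i ω = ((X i ω)ᵀ * Astar).trace + ξ i ω)
    (hξ : IsIID P ξ) {D σ H lam : ℝ} (hD : 0 ≤ D) (hσ : 0 ≤ σ) (hH : 0 ≤ H)
    (hmgf : ∀ i, HasBernsteinMGF P σ H (ξ i)) (hzero : σ = 0 → ∀ i, ξ i =ᵐ[P] 0)
    (hlam : 4 * bernsteinLevel m T N σ H D ≤ lam) {Ahat : Ω → Matrix (Fin m) (Fin T) ℝ}
    (hA : ∀ᵐ ω ∂P, IsSchattenEstimate 1 lam (fun i => X i ω) (fun i => Y i ω) (Ahat ω)) :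
    HoldsWithProbAtLeast P (1 - 2 * Real.exp (-((D - Real.log 5) * ((m : ℝ) + T))))
      (fun ω => predictionDist (fun i => X i ω) (Ahat ω) Astar ^ 2 ≤
        2 * lam * schattenNorm 1 Astar) := by
  classical
  obtain ⟨S, hSc, hS1, hSnet⟩ := exists_half_net (EuclideanSpace ℝ (Fin T))
  obtain ⟨S', hSc', hS1', hSnet'⟩ := exists_half_net (EuclideanSpace ℝ (Fin m))
  rw [finrank_euclideanSpace_fin] at hSc hSc'
  obtain ⟨s, hs⟩ : ∃ s, s = 2 * σ * √(2 * D * ((m : ℝ) + T)) + 4 * H * D * ((m : ℝ) + T) :=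
    ⟨_, rfl⟩
  let Z : Ω → Fin N × Fin m × Fin T → ℝ := fun ω a => X a.1 ω a.2.1 a.2.2
  let z : (Fin N → Fin m × Fin T) → Fin N × Fin m × Fin T → ℝ :=
    fun κ a => Matrix.single (κ a.1).1 (κ a.1).2 (1 : ℝ) a.2.1 a.2.2
  -- The admissible mask patterns: injective placements of the N observations.
  let K : Finset (Fin N → Fin m × Fin T) := Finset.univ.filter Function.Injective
  let G : (Fin N → Fin m × Fin T) → Set (Fin N → ℝ) := fun κ =>
    {y | ∀ v ∈ S, ∀ u ∈ S', |∑ i, u (κ i).1 * v (κ i).2 * y i| ≤ s}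
  have hZm : Measurable Z := measurable_pi_lambda _ fun a => hX.measurable_entry a.1 a.2.1 a.2.2
  have hξm : Measurable fun ω i => ξ i ω := measurable_pi_lambda _ hξ.measurable
  have hz : Function.Injective z := by
    intro κ κ' h
    funext i
    have h1 := congrFun h (i, (κ i).1, (κ i).2)
    simp only [z, Matrix.single_apply_same] at h1
    by_contra hne
    rw [Matrix.single_apply_of_ne _ _ _ _ _ fun h => hne (Prod.ext h.1.symm h.2.symm)] at h1
    exact one_ne_zero h1
  have hmem : ∀ᵐ ω ∂P, ∀ i, X i ω ∈ pointMasks m T := ae_all_iff.2 hX.mem_pointMasks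
  have hdist : ∀ᵐ ω ∂P, ∀ i j, i ≠ j → X i ω ≠ X j ω := by
    simp only [ae_all_iff]
    exact hX.distinct
  have hcover : ∀ᵐ ω ∂P, ∃ κ ∈ K, Z ω = z κ := by
    filter_upwards [hmem, hdist] with ω h1 h2
    obtain ⟨κ, hκ, hXκ⟩ := exists_pos_of_pointMasks h1 h2
    exact ⟨κ, by simp [K, hκ], by funext a; simp only [Z, z, hXκ]⟩
  have hGm : ∀ κ, MeasurableSet (G κ) := by
    intro κ
    simp only [G, Set.ofPred_forall]
    refine Finset.measurableSet_biInter _ fun v _ => Finset.measurableSet_biInter _ fun u _ => ?_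
    exact measurableSet_le (by fun_prop) measurable_const
  have hprob := le_measureReal_iUnion_inter_of_indepFun hZm hξm hX.indep hz hcover hGm
    fun κ hκ => le_measureReal_forall_net_abs_le hD hσ hH hs hξ.measurable hξ.indep hmgf hzero
      (Finset.mem_filter.1 hκ).2 hSc hSc' hS1 hS1'
  -- The estimator need not be measurable: the good event is built from masks and errors alone,
  -- minus a measurable null set outside which Â is a minimizer.
  obtain ⟨E₀, hE₀, hE₀m, hE₀P⟩ := exists_measurable_superset_of_null (ae_iff.1 hA)
  refine ⟨(⋃ κ ∈ K, Z ⁻¹' {z κ} ∩ (fun ω i => ξ i ω) ⁻¹' G κ) \ E₀,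
    (Finset.measurableSet_biUnion _ fun κ _ =>
      (hZm (measurableSet_singleton _)).inter (hξm (hGm κ))).diff hE₀m, ?_, ?_⟩
  · rwa [measureReal_def, measure_sdiff_null hE₀P, ← measureReal_def]
  · rintro ω ⟨hω, hω₀⟩
    have hest : IsSchattenEstimate 1 lam (fun i => X i ω) (fun i => Y i ω) (Ahat ω) := by
      by_contra hcon
      exact hω₀ (hE₀ hcon)
    simp only [hY] at hest
    simp only [Set.mem_iUnion, Set.mem_inter_iff, Set.mem_preimage, Set.mem_singleton_iff] at hω
    obtain ⟨κ, -, hZκ, hGκ⟩ := hω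
    have hXκ : ∀ i, X i ω = Matrix.single (κ i).1 (κ i).2 1 := fun i => by
      ext k l
      exact congrFun hZκ (i, k, l)
    refine sq_predictionDist_le_of_opNorm_le hest ?_
    have hop : ‖(Matrix.toEuclideanLin (∑ i, ξ i ω • X i ω)).toContinuousLinearMap‖ ≤ 4 * s := by
      refine opNorm_le_of_half_nets _ hSnet hSnet' fun v hv u hu => ?_
      simp only [hXκ, LinearMap.coe_toContinuousLinearMap']
      rw [inner_toEuclideanLin_sum_smul_single]
      exact hGκ v hv u hu
    have hN' : (0 : ℝ) < N := Nat.cast_pos.2 hN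
    calc 2 / N * ‖(Matrix.toEuclideanLin (∑ i, ξ i ω • X i ω)).toContinuousLinearMap‖
        ≤ 2 / N * (4 * s) := by gcongr
      _ = 4 * bernsteinLevel m T N σ H D := by
        rw [bernsteinLevel, hs]
        ring
      _ ≤ lam := hlam

/-- The constants are 4√2 and 8, so the Gaussian λ exceeds what the case H = 0 needs. -/
theorem bernsteinLevel_zero_le_gaussianLevel (m T N : ℕ) {σ D : ℝ} (hσ : 0 ≤ σ) (hD : 0 ≤ D) :
    bernsteinLevel m T N σ 0 D ≤ gaussianLevel m T N σ D := by
  have h2 : √(2 : ℝ) ≤ 2 := by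
    rw [Real.sqrt_le_left (by norm_num)]
    norm_num
  rw [bernsteinLevel, gaussianLevel, Real.sqrt_mul (by positivity), Real.sqrt_mul (by norm_num)]
  calc (4 * σ * (√2 * √D * √((m : ℝ) + T)) + 8 * 0 * D * ((m : ℝ) + T)) / N
      = √2 * (4 * σ * √D * (√((m : ℝ) + T) / N)) := by ring
    _ ≤ 2 * (4 * σ * √D * (√((m : ℝ) + T) / N)) := by gcongr
    _ = _ := by ring

end TraceRegression

theorem corollary3 {m T N : ℕ} (hN : 0 < N)
    {Ω : Type*} [MeasurableSpace Ω] (P : Measure Ω) [IsProbabilityMeasure P]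
    (Astar : Matrix (Fin m) (Fin T) ℝ)
    (X : Fin N → Ω → Matrix (Fin m) (Fin T) ℝ) (ξ Y : Fin N → Ω → ℝ)
    (hX : TraceRegression.CollaborativeSampling P X ξ)
    (hY : ∀ i ω, Y i ω = ((X i ω)ᵀ * Astar).trace + ξ i ω)
    (hξ : TraceRegression.IsIID P ξ)
    (D σ : ℝ) (hD : 2 ≤ D) (hσ : 0 ≤ σ) (Ahat : Ω → Matrix (Fin m) (Fin T) ℝ) :
    -- (i) Gaussian errors
    ((∀ i, HasLaw (ξ i) (gaussianReal 0 (σ ^ 2).toNNReal) P) →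
      (∀ᵐ ω ∂P, TraceRegression.IsSchattenEstimate 1
        (4 * TraceRegression.gaussianLevel m T N σ D)
        (fun i => X i ω) (fun i => Y i ω) (Ahat ω)) →
      TraceRegression.HoldsWithProbAtLeast P
        (1 - 2 * Real.exp (-((D - Real.log 5) * ((m : ℝ) + T))))
        (fun ω => TraceRegression.predictionDist (fun i => X i ω) (Ahat ω) Astar ^ 2 ≤
          16 * (8 * σ * √D) * TraceRegression.schattenNorm 1 Astar * (√((m : ℝ) + T) / N))) ∧
    -- (ii) errors satisfying the Bernstein condition
    (∀ H : ℝ, 0 ≤ H →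
      (∀ i, Integrable (ξ i) P ∧ ∫ ω, ξ i ω ∂P = 0) →
      TraceRegression.BernsteinCondition P σ H ξ →
      (∀ᵐ ω ∂P, TraceRegression.IsSchattenEstimate 1
        (4 * TraceRegression.bernsteinLevel m T N σ H D)
        (fun i => X i ω) (fun i => Y i ω) (Ahat ω)) →
      TraceRegression.HoldsWithProbAtLeast P
        (1 - 2 * Real.exp (-((D - Real.log 5) * ((m : ℝ) + T))))
        (fun ω => TraceRegression.predictionDist (fun i => X i ω) (Ahat ω) Astar ^ 2 ≤
          64 * TraceRegression.schattenNorm 1 Astar *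
            ((σ * √(2 * D * ((m : ℝ) + T)) + 2 * H * D * ((m : ℝ) + T)) / N))) := by
  have hD0 : 0 ≤ D := by linarith
  have hA0 := TraceRegression.schattenNorm_one_nonneg Astar
  refine ⟨fun hlaw hest => ?_, fun H hH hmean hbern hest => ?_⟩
  · have hzero : σ = 0 → ∀ i, ξ i =ᵐ[P] 0 := by
      intro h0 i
      have h := (hlaw i).map_eq
      rw [h0, zero_pow two_ne_zero, Real.toNNReal_zero, gaussianReal_zero_var] at h
      have hae : ∀ᵐ y ∂(P.map (ξ i)), y = 0 := by
        rw [h]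
        simp [ae_dirac_eq]
      exact ae_of_ae_map (hlaw i).aemeasurable hae
    obtain ⟨E, hE, hq, hQ⟩ := TraceRegression.holdsWithProb_of_hasBernsteinMGF hN hX hY hξ hD0 hσ
      le_rfl (fun i => TraceRegression.hasBernsteinMGF_of_gaussian (hlaw i)) hzero
      (mul_le_mul_of_nonneg_left
        (TraceRegression.bernsteinLevel_zero_le_gaussianLevel m T N hσ hD0) (by norm_num)) hest
    -- With λ = 4τ the oracle bound is 8τ‖A*‖₁, half of the claimed 16τ‖A*‖₁.
    refine ⟨E, hE, hq, fun ω hω => (hQ ω hω).trans ?_⟩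
    have hlev : 0 ≤ TraceRegression.gaussianLevel m T N σ D := by
      rw [TraceRegression.gaussianLevel]
      positivity
    have h16 : 16 * (8 * σ * √D) * TraceRegression.schattenNorm 1 Astar * (√((m : ℝ) + T) / N) =
        16 * (TraceRegression.gaussianLevel m T N σ D * TraceRegression.schattenNorm 1 Astar) := by
      rw [TraceRegression.gaussianLevel]
      ring
    rw [h16]
    linarith [mul_nonneg hlev hA0]
  -- For σ = 0 the condition at l = 2 gives zero second moment (with H^0 = 1).
  · have hzero : σ = 0 → ∀ i, ξ i =ᵐ[P] 0 := by
      intro h0 i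
      obtain ⟨hint, hle⟩ := hbern i 2 le_rfl
      simp only [sq_abs] at hint hle
      have h2 : ∫ ω, ξ i ω ^ 2 ∂P = 0 :=
        le_antisymm (hle.trans_eq (by simp [h0])) (integral_nonneg fun ω => sq_nonneg _)
      rw [integral_eq_zero_iff_of_nonneg (fun ω => sq_nonneg _) hint] at h2
      filter_upwards [h2] with ω hω
      exact pow_eq_zero_iff two_ne_zero |>.1 hω
    obtain ⟨E, hE, hq, hQ⟩ := TraceRegression.holdsWithProb_of_hasBernsteinMGF hN hX hY hξ hD0 hσ
      hH (fun i => TraceRegression.hasBernsteinMGF_of_moments hH (hξ.measurable i) (hmean i).1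
        (hmean i).2 (hbern i)) hzero le_rfl hest
    refine ⟨E, hE, hq, fun ω hω => (hQ ω hω).trans ?_⟩
    have hlev : 0 ≤ TraceRegression.bernsteinLevel m T N σ H D := by
      rw [TraceRegression.bernsteinLevel]
      positivity
    have h16 : 64 * TraceRegression.schattenNorm 1 Astar *
        ((σ * √(2 * D * ((m : ℝ) + T)) + 2 * H * D * ((m : ℝ) + T)) / N) =
        16 * (TraceRegression.bernsteinLevel m T N σ H D *
          TraceRegression.schattenNorm 1 Astar) := by
      rw [TraceRegression.bernsteinLevel]
      ring
    rw [h16]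
    linarith [mul_nonneg hlev hA0]
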